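/- Let $q(X)=q_1x_1^2+b_{12}x_1x_2+b_{13}x_1x_3+q_2x_2^2+b_{23}x_2x_3+q_3x_3^2$ be a nonsingular ternary quadratic form with integer coefficients. Put $$Q_0=\begin{pmatrix} q_1&b_{12}&b_{13}\\0&q_2&b_{23}\\0&0&q_3\end{pmatrix},\quad B=\begin{pmatrix}-b_{23}\\b_{13}\\-b_{12}\end{pmatrix},\quad Q={}^tQ_0+Q_0,\quad N=\begin{pmatrix}2&-{}^tB\\-B&{}^t\tilde Q_0+\tilde Q_0\end{pmatrix},$$ where $\tilde Q_0$ is the adjugate of $Q_0$, and $\det q=\det Q\neq0$. ($N$ is the matrix of the norm form on the even Clifford algebra of $(\mathbb Z^3,q)$ in the basis $1,e_2e_3,-e_1e_3,e_1e_2$.) Write $L[M]={}^tMLM$, $\Lambda^n=GL_n(\mathbb Z)$; congruences of matrices are entrywise. Let $p$ be a prime not dividing $\det q$, and put $D_p=\mathrm{diag}(1,p,p^2)$ and $\mathcal D_p=\mathrm{diag}(1,1,p,p)$. For an integral $3\times3$ matrix $A$ with columns $A_1,A_2,A_3$ and adjugate $\tilde A$ put $$\Psi_A=\begin{pmatrix}1&{}^tA_3Q_0A_2&-{}^tA_3Q_0A_1&{}^tA_2Q_0A_1\\0&&&\\0&&{}^t\tilde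 A&\\0&&&\end{pmatrix}\cdot\mathrm{diag}(p,p^{-1},p^{-1},p^{-1}).$$ A matrix $M\in\mathbb Z^{4\times4}$ left-divides $\Psi_A$, written $M\mid\Psi_A$, if $\Psi_A=MX$ for some $X\in\mathbb Z^{4\times4}$. Theorem 6.5. For every coset $\mathcal M\in\Lambda^4\mathcal D_p\Lambda^4/\Lambda^4$ whose representatives $M$ satisfy $N[M]\equiv0\pmod p$, there is a unique coset $\mathcal A\in\Lambda^3D_p\Lambda^3/\Lambda^3$ whose representatives $A$ satisfy $Q[A]\equiv0\pmod{p^2}$ and $M\mid\Psi_A$. These conditions do not depend on the choice of representatives: for each $M\in\mathcal M$ the set of all $A\in\Lambda^3D_p\Lambda^3$ with $Q[A]\equiv0\pmod{p^2}$ and $M\mid\Psi_A$ is exactly the coset $\mathcal A$. Moreover, for every $A\in\Lambda^3D_p\Lambda^3$ with $Q[A]\equiv0\pmod{p^2}$, the matrix $\Psi_A$ is integral and its reduction modulo $p$ has rank $1$ over $\mathbb F_p$. -/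

import Mathlib

open scoped Matrix

namespace CliffordLift

/-- An integral ternary quadratic form
`q₁x₁² + b₁₂x₁x₂ + b₁₃x₁x₃ + q₂x₂² + b₂₃x₂x₃ + q₃x₃²`, given by its coefficients. -/
structure TernaryForm where
  q₁ : ℤ
  q₂ : ℤ
  q₃ : ℤ
  b₁₂ : ℤ
  b₁₃ : ℤ
  b₂₃ : ℤ

namespace TernaryForm

/-- The upper triangular coefficient matrix `Q₀`; the form is `X ↦ ᵗX Q₀ X`. -/
def Q₀ (q : TernaryForm) : Matrix (Fin 3) (Fin 3) ℤ :=
  !![q.q₁, q.b₁₂, q.b₁₃;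
     0,    q.q₂,  q.b₂₃;
     0,    0,     q.q₃]

/-- The (even, symmetric) matrix `Q = ᵗQ₀ + Q₀` of the form; `det q` is `det Q`. -/
def Q (q : TernaryForm) : Matrix (Fin 3) (Fin 3) ℤ := q.Q₀ᵀ + q.Q₀

/-- The column `B = ᵗ(-b₂₃, b₁₃, -b₁₂)`. -/
def B (q : TernaryForm) : Fin 3 → ℤ := ![-q.b₂₃, q.b₁₃, -q.b₁₂]

/-- The lower right `3 × 3` block `ᵗQ₀~ + Q₀~` of `N`, where `Q₀~` is the adjugate of `Q₀`. -/
def normBlock (q : TernaryForm) : Matrix (Fin 3) (Fin 3) ℤ :=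
  q.Q₀.adjugateᵀ + q.Q₀.adjugate

/-- The matrix `N`, in block form `(2, -ᵗB; -B, ᵗQ₀~ + Q₀~)`, of the norm form `x ↦ x x̄` on the
even Clifford algebra of `(ℤ³, q)`, with respect to the basis `1, e₂e₃, -e₁e₃, e₁e₂`. -/
def N (q : TernaryForm) : Matrix (Fin 4) (Fin 4) ℤ :=
  !![2,        -q.B 0,            -q.B 1,            -q.B 2;
     -q.B 0,   q.normBlock 0 0,   q.normBlock 0 1,   q.normBlock 0 2;
     -q.B 1,   q.normBlock 1 0,   q.normBlock 1 1,   q.normBlock 1 2;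
     -q.B 2,   q.normBlock 2 0,   q.normBlock 2 1,   q.normBlock 2 2]

/-- The number `ᵗA_i Q₀ A_j`, where `A_j` is the `j`-th column of `A`. -/
def colPair (q : TernaryForm) (A : Matrix (Fin 3) (Fin 3) ℤ) (i j : Fin 3) : ℤ :=
  A.col i ⬝ᵥ (q.Q₀ *ᵥ A.col j)

/-- The matrix `Φ_A`, with respect to the bases `1, e₂e₃, -e₁e₃, e₁e₂`, of the ring homomorphism
from the even Clifford algebra of `q[A]` to that of `q` which is induced by the isometry
`X ↦ A X` from `(ℤ³, q[A])` to `(ℤ³, q)`. Its first column is `(1, 0, 0, 0)`, the rest of its first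
row is `(ᵗA₃Q₀A₂, -ᵗA₃Q₀A₁, ᵗA₂Q₀A₁)`, and its lower right block is the transposed adjugate
(the cofactor matrix) of `A`. -/
def Φ (q : TernaryForm) (A : Matrix (Fin 3) (Fin 3) ℤ) : Matrix (Fin 4) (Fin 4) ℤ :=
  !![1, q.colPair A 2 1,     -q.colPair A 2 0,   q.colPair A 1 0;
     0, A.adjugateᵀ 0 0,     A.adjugateᵀ 0 1,    A.adjugateᵀ 0 2;
     0, A.adjugateᵀ 1 0,     A.adjugateᵀ 1 1,    A.adjugateᵀ 1 2;
     0, A.adjugateᵀ 2 0,     A.adjugateᵀ 2 1,    A.adjugateᵀ 2 2]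

/-- The lift `Ψ_A = Φ_A · diag(p, p⁻¹, p⁻¹, p⁻¹)`, a priori a rational matrix. -/
def Ψ (q : TernaryForm) (p : ℕ) (A : Matrix (Fin 3) (Fin 3) ℤ) : Matrix (Fin 4) (Fin 4) ℚ :=
  (q.Φ A).map (Int.cast : ℤ → ℚ) *
    Matrix.diagonal ![(p : ℚ), (p : ℚ)⁻¹, (p : ℚ)⁻¹, (p : ℚ)⁻¹]

end TernaryForm

/-- The matrix `L[M] = ᵗM L M`. -/
def transform {n : ℕ} (L M : Matrix (Fin n) (Fin n) ℤ) : Matrix (Fin n) (Fin n) ℤ := Mᵀ * L * M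

/-- The entrywise congruence `L ≡ 0 (mod m)`. -/
def CongZero {n : ℕ} (m : ℕ) (L : Matrix (Fin n) (Fin n) ℤ) : Prop := ∀ i j, (m : ℤ) ∣ L i j

/-- The double coset `Λⁿ D Λⁿ`, where `Λⁿ = GL_n(ℤ)`. -/
def doubleCoset {n : ℕ} (D : Matrix (Fin n) (Fin n) ℤ) : Set (Matrix (Fin n) (Fin n) ℤ) :=
  {M | ∃ U V : GL (Fin n) ℤ, M = U.val * D * V.val}

/-- The coset `M Λⁿ`. -/
def coset {n : ℕ} (M : Matrix (Fin n) (Fin n) ℤ) : Set (Matrix (Fin n) (Fin n) ℤ) :=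
  {M' | ∃ U : GL (Fin n) ℤ, M' = M * U.val}

/-- The set `Λⁿ D Λⁿ / Λⁿ` of the cosets `M Λⁿ` contained in `Λⁿ D Λⁿ`. -/
def cosets {n : ℕ} (D : Matrix (Fin n) (Fin n) ℤ) : Set (Set (Matrix (Fin n) (Fin n) ℤ)) :=
  {S | ∃ M ∈ doubleCoset D, S = coset M}

/-- `M ∣ P` from the left: `P = M X` with an integral matrix `X`. -/
def LeftDivides (M : Matrix (Fin 4) (Fin 4) ℤ) (P : Matrix (Fin 4) (Fin 4) ℚ) : Prop :=
  ∃ X : Matrix (Fin 4) (Fin 4) ℤ, P = (M * X).map (Int.cast : ℤ → ℚ)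

/-- `P` is an integral matrix whose reduction modulo `p` has rank `r`. -/
def IsIntegralOfRankMod (p r : ℕ) (P : Matrix (Fin 4) (Fin 4) ℚ) : Prop :=
  ∃ P₀ : Matrix (Fin 4) (Fin 4) ℤ, P = P₀.map (Int.cast : ℤ → ℚ) ∧
    (P₀.map (Int.cast : ℤ → ZMod p)).rank = r

/-- The elementary divisor matrix `diag(1, p, p²)`. -/
def D₃ (p : ℕ) : Matrix (Fin 3) (Fin 3) ℤ := Matrix.diagonal ![1, (p : ℤ), (p : ℤ) ^ 2]

/-- The elementary divisor matrix `diag(1, 1, p, p)`. -/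
def D₄ (p : ℕ) : Matrix (Fin 4) (Fin 4) ℤ := Matrix.diagonal ![1, 1, (p : ℤ), (p : ℤ)]

end CliffordLift

/-! Since `det Q` is even, `p` is odd. Modulo `p`, the coset of `M = T D₄ V` is the plane spanned by
the first two columns of `T`, and the congruence on `N[M]` makes this plane totally isotropic. For
`A = U D₃ V` with `u`, `v` the first two columns of `U`, the congruence on `Q[A]` says that `q.polar
u u ≡ 0 (mod p²)` and `q.polar u v ≡ 0 (mod p)`; the coset of `A` then depends only on the line of
`u` modulo `p` (`IsFrame.mem_coset`).

The bridge is `Ψ_eq`: modulo `p`, `Ψ_A` is the outer product of `w = q.pairVec u v` with a primitive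
row of minors of `V`. Hence it has rank one, and `M ∣ Ψ_A` means that `w` lies in the plane of `M`
(`leftDivides_iff_inPlane`). The trace of `w` is `q.polar u v ≡ 0`. The trace is the pairing with
`1`, so it cannot vanish on an isotropic plane: that plane is its own orthogonal complement and
would contain `1`, whereas `1` pairs with itself to `2`. Each plane thus contains exactly one line
of trace zero.

That line determines `u`, because the last three coordinates of `w` are proportional to `Q u` modulo
`p` (`IsFrame.par`). Conversely, the line yields an isotropic `u` through `adj Q`, which a Hensel
step lifts modulo `p²` (`exists_isFrame`). -/

namespace CliffordLift

/-! ### Trace, norm and discriminant identities -/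

/-- The element `(ᵗy Q₀ x, x × y)` of the even Clifford algebra; up to conjugation it is the
product of `x` and `y`. -/
def TernaryForm.pairVec (q : TernaryForm) (x y : Fin 3 → ℤ) : Fin 4 → ℤ :=
  ![y ⬝ᵥ (q.Q₀ *ᵥ x), x 1 * y 2 - x 2 * y 1, x 2 * y 0 - x 0 * y 2, x 0 * y 1 - x 1 * y 0]

/-- The polar form `ᵗx Q y`. -/
def TernaryForm.polar (q : TernaryForm) (x y : Fin 3 → ℤ) : ℤ := x ⬝ᵥ (q.Q *ᵥ y)

/-- The reduced trace on the even Clifford algebra. -/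
def TernaryForm.trace (q : TernaryForm) (w : Fin 4 → ℤ) : ℤ :=
  2 * w 0 - (q.B 0 * w 1 + q.B 1 * w 2 + q.B 2 * w 3)

theorem TernaryForm.polar_eq (q : TernaryForm) (x y : Fin 3 → ℤ) : q.polar x y =
    2 * q.q₁ * x 0 * y 0 + 2 * q.q₂ * x 1 * y 1 + 2 * q.q₃ * x 2 * y 2 +
    q.b₁₂ * (x 0 * y 1 + x 1 * y 0) + q.b₁₃ * (x 0 * y 2 + x 2 * y 0) +
    q.b₂₃ * (x 1 * y 2 + x 2 * y 1) := by
  simp [TernaryForm.polar, TernaryForm.Q, TernaryForm.Q₀, Matrix.mulVec, dotProduct,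
    Fin.sum_univ_three]
  ring

theorem TernaryForm.trace_pairVec (q : TernaryForm) (x y : Fin 3 → ℤ) :
    q.trace (q.pairVec x y) = q.polar x y := by
  rw [TernaryForm.polar_eq]
  simp [TernaryForm.trace, TernaryForm.pairVec, TernaryForm.B, TernaryForm.Q₀, Matrix.mulVec,
    dotProduct, Fin.sum_univ_three]
  ring

/-- Half of the determinant of `Q`. -/
def TernaryForm.halfDisc (q : TernaryForm) : ℤ :=
  4 * q.q₁ * q.q₂ * q.q₃ + q.b₁₂ * q.b₁₃ * q.b₂₃ - q.q₁ * q.b₂₃ ^ 2 - q.q₂ * q.b₁₃ ^ 2 -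
    q.q₃ * q.b₁₂ ^ 2

theorem TernaryForm.det_Q (q : TernaryForm) : q.Q.det = 2 * q.halfDisc := by
  simp [TernaryForm.Q, TernaryForm.Q₀, Matrix.det_fin_three, TernaryForm.halfDisc]
  ring

theorem TernaryForm.det_N (q : TernaryForm) : q.N.det = q.halfDisc ^ 2 := by
  simp [TernaryForm.N, TernaryForm.normBlock, TernaryForm.B, TernaryForm.Q₀,
    Matrix.adjugate_fin_three, Matrix.det_succ_row_zero, Fin.sum_univ_succ, Fin.succAbove,
    TernaryForm.halfDisc]
  ring

/-- Completing the square in `w 0`. On trace zero vectors the norm form becomes the form of `adj Q`,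
the link between isotropic `w` and isotropic `u`. -/
theorem TernaryForm.norm_eq (q : TernaryForm) (w : Fin 4 → ℤ) :
    2 * (w ⬝ᵥ (q.N *ᵥ w)) = q.trace w ^ 2 +
      ![w 1, w 2, w 3] ⬝ᵥ (q.Q.adjugate *ᵥ ![w 1, w 2, w 3]) := by
  simp [TernaryForm.N, TernaryForm.normBlock, TernaryForm.B, TernaryForm.Q₀, TernaryForm.Q,
    Matrix.adjugate_fin_three, TernaryForm.trace, Matrix.mulVec, dotProduct, Fin.sum_univ_succ]
  ring

theorem TernaryForm.trace_eq (q : TernaryForm) (w : Fin 4 → ℤ) :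
    q.trace w = (q.N *ᵥ w) 0 := by
  simp [TernaryForm.N, TernaryForm.trace, Matrix.mulVec, dotProduct, Fin.sum_univ_succ]
  ring

theorem TernaryForm.N_transpose (q : TernaryForm) : q.Nᵀ = q.N := by
  ext i j
  fin_cases i <;> fin_cases j <;> simp [TernaryForm.N, TernaryForm.normBlock] <;> ring

/-- The cross products of the columns of `U`, divided by `det U`, form the dual basis, and `Q u` has
coordinates `q.polar u (U.col i)` in it. -/
theorem TernaryForm.det_smul_mulVec (q : TernaryForm) (U : Matrix (Fin 3) (Fin 3) ℤ) (i : Fin 3) :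
    U.det * (q.Q *ᵥ U.col 0) i =
      q.polar (U.col 0) (U.col 0) * q.pairVec (U.col 1) (U.col 2) i.succ +
      q.polar (U.col 0) (U.col 1) * q.pairVec (U.col 2) (U.col 0) i.succ +
      q.polar (U.col 0) (U.col 2) * q.pairVec (U.col 0) (U.col 1) i.succ := by
  simp only [TernaryForm.polar_eq, Matrix.det_fin_three]
  fin_cases i <;>
  simp [TernaryForm.pairVec, TernaryForm.Q, TernaryForm.Q₀, Matrix.mulVec, dotProduct,
    Fin.sum_univ_three, Matrix.col] <;> ring

/-- The expansion of `pairVec` on the sublattice spanned by `u`, `p v`, `p² s`. -/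
theorem TernaryForm.pairVec_expand (q : TernaryForm) (p a b : ℤ) (u v s x y : Fin 3 → ℤ)
    (hu : u ⬝ᵥ (q.Q₀ *ᵥ u) = p ^ 2 * a) (hv : q.polar u v = p * b) :
    ∃ r : Fin 4 → ℤ, ∀ i, q.pairVec (x 0 • u + (p * x 1) • v + (p ^ 2 * x 2) • s)
      (y 0 • u + (p * y 1) • v + (p ^ 2 * y 2) • s) i =
      p * ((x 0 * y 1 - x 1 * y 0) * q.pairVec u v i + p * r i) := by
  refine ⟨(x 0 * y 0 * a + x 1 * y 0 * b) • ![1, 0, 0, 0] + (x 1 * y 1) • q.pairVec v v +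
    (x 0 * y 2) • q.pairVec u s + (x 2 * y 0) • q.pairVec s u + (p * x 1 * y 2) • q.pairVec v s +
    (p * x 2 * y 1) • q.pairVec s v + (p ^ 2 * x 2 * y 2) • q.pairVec s s, fun i => ?_⟩
  rw [TernaryForm.polar_eq] at hv
  simp [TernaryForm.Q₀, Matrix.mulVec, dotProduct, Fin.sum_univ_three] at hu
  fin_cases i
  · simp [TernaryForm.pairVec, TernaryForm.Q₀, Matrix.mulVec, dotProduct, Fin.sum_univ_three]
    -- Replacing `ᵗu Q₀ v` by `p b - ᵗv Q₀ u` makes the mixed terms antisymmetric in `x`, `y`, up to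
    -- a multiple of `p²`.
    linear_combination (x 0 * y 0) * hu + (p * x 1 * y 0) * hv
  all_goals
    simp [TernaryForm.pairVec]
    ring

/-! ### Completion to unimodular matrices -/

theorem exists_gcd_factor (a b : ℤ) :
    ∃ g a' b' s t : ℤ, a = g * a' ∧ b = g * b' ∧ s * a' + t * b' = 1 := by
  by_cases h : Int.gcd a b = 0
  · rw [Int.gcd_eq_zero_iff] at h
    exact ⟨0, 1, 0, 1, 0, by simp [h.1], by simp [h.2], by norm_num⟩
  · obtain ⟨a', ha⟩ := Int.gcd_dvd_left a b
    obtain ⟨b', hb⟩ := Int.gcd_dvd_right a b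
    refine ⟨Int.gcd a b, a', b', Int.gcdA a b, Int.gcdB a b, ha, hb, ?_⟩
    have h0 : (Int.gcd a b : ℤ) ≠ 0 := by exact_mod_cast h
    apply mul_left_cancel₀ h0
    linear_combination (-Int.gcdA a b) * ha - Int.gcdB a b * hb - Int.gcd_eq_gcd_ab a b

/-- Every integral vector is a multiple of the first column of a unimodular matrix. -/
theorem exists_gl_col_zero (x : Fin 3 → ℤ) :
    ∃ (U : GL (Fin 3) ℤ) (g : ℤ), ∀ i, x i = g * U.val i 0 := by
  obtain ⟨g, a, b, s, t, ha, hb, hab⟩ := exists_gcd_factor (x 0) (x 1)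
  obtain ⟨h, g', c, s', t', hg, hc, hgc⟩ := exists_gcd_factor g (x 2)
  -- Two nested Bézout completions: first of `(a, b)` by `(-t, s)`, then of `(g', c)` by `(-t',
  -- s')`.
  have hdet : (!![g' * a, -t, -t' * a; g' * b, s, -t' * b; c, 0, s'] :
      Matrix (Fin 3) (Fin 3) ℤ).det = 1 := by
    simp [Matrix.det_fin_three]
    linear_combination (s' * g' + t' * c) * hab + hgc
  obtain ⟨U, hU⟩ := (Matrix.isUnit_iff_isUnit_det _).2 (hdet ▸ isUnit_one)
  refine ⟨U, h, fun i => ?_⟩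
  rw [hU]
  fin_cases i
  · simp [ha, hg, mul_assoc]
  · simp [hb, hg, mul_assoc]
  · simpa using hc

/-! ### Congruences on cosets and frames -/

theorem transform_mul {n : ℕ} (L A C : Matrix (Fin n) (Fin n) ℤ) :
    transform L (A * C) = transform (transform L A) C := by
  simp [transform, Matrix.transpose_mul, Matrix.mul_assoc]

theorem CongZero.transform {n m : ℕ} {L : Matrix (Fin n) (Fin n) ℤ} (h : CongZero m L)
    (V : Matrix (Fin n) (Fin n) ℤ) : CongZero m (transform L V) := fun i j => by
  simp only [CliffordLift.transform, Matrix.mul_apply]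
  exact Finset.dvd_sum fun k _ => Dvd.dvd.mul_right
    (Finset.dvd_sum fun l _ => Dvd.dvd.mul_left (h _ _) _) _

theorem congZero_transform_mul_unit {n m : ℕ} (L A : Matrix (Fin n) (Fin n) ℤ)
    (V : GL (Fin n) ℤ) :
    CongZero m (transform L (A * V.val)) ↔ CongZero m (transform L A) := by
  refine ⟨fun h => ?_, fun h => transform_mul L A V.val ▸ h.transform _⟩
  have := h.transform (V⁻¹).val
  rwa [← transform_mul, Matrix.mul_assoc, ← Units.val_mul, mul_inv_cancel, Units.val_one,
    Matrix.mul_one] at this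

/-- The first two columns `u`, `v` of `U` satisfy `ᵗu Q u ≡ 0 (mod p²)`, `ᵗu Q v ≡ 0 (mod p)`. -/
def TernaryForm.IsFrame (q : TernaryForm) (p : ℕ) (U : Matrix (Fin 3) (Fin 3) ℤ) : Prop :=
  (p : ℤ) ^ 2 ∣ q.polar (U.col 0) (U.col 0) ∧ (p : ℤ) ∣ q.polar (U.col 0) (U.col 1)

theorem TernaryForm.polar_comm (q : TernaryForm) (x y : Fin 3 → ℤ) :
    q.polar x y = q.polar y x := by
  simp only [TernaryForm.polar_eq]; ring

theorem TernaryForm.transform_Q_apply (q : TernaryForm) (A : Matrix (Fin 3) (Fin 3) ℤ)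
    (i j : Fin 3) : transform q.Q A i j = q.polar (A.col i) (A.col j) := by
  rw [transform, Matrix.mul_assoc, Matrix.mul_apply]
  simp only [TernaryForm.polar, Matrix.mul_apply, dotProduct, Matrix.mulVec,
    Matrix.transpose_apply, Matrix.col_apply]

theorem TernaryForm.polar_smul_smul (q : TernaryForm) (a b : ℤ) (x y : Fin 3 → ℤ) :
    q.polar (a • x) (b • y) = a * b * q.polar x y := by
  simp only [TernaryForm.polar_eq, Pi.smul_apply, smul_eq_mul]; ring

theorem col_mul_D₃ (p : ℕ) (U : Matrix (Fin 3) (Fin 3) ℤ) (j : Fin 3) :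
    (U * D₃ p).col j = (![1, (p : ℤ), (p : ℤ) ^ 2] j) • U.col j := by
  ext i
  simp [D₃, Matrix.col_apply, mul_comm]

/-- The factor `V` is invertible, and entry `(i, j)` of `Q[U D₃]` carries a factor `p ^ (i + j)`. So
only the entries `(0, 0)`, `(0, 1)` and `(1, 0)` impose a condition. -/
theorem TernaryForm.congZero_iff_isFrame (q : TernaryForm) {p : ℕ} (hp : p ≠ 0)
    (U V : GL (Fin 3) ℤ) :
    CongZero (p ^ 2) (transform q.Q (U.val * D₃ p * V.val)) ↔ q.IsFrame p U.val := by
  have h0 : (p : ℤ) ≠ 0 := by exact_mod_cast hp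
  rw [congZero_transform_mul_unit]
  simp only [CongZero, TernaryForm.transform_Q_apply, col_mul_D₃, TernaryForm.polar_smul_smul]
  push_cast
  constructor
  · intro h
    refine ⟨by simpa using h 0 0, ?_⟩
    have := h 0 1
    simp only [Matrix.cons_val_zero, Matrix.cons_val_one, one_mul, pow_two] at this
    exact (mul_dvd_mul_iff_left h0).1 this
  · rintro ⟨h1, h2⟩ i j
    have h3 : (p : ℤ) ^ 2 ∣ p * q.polar (U.val.col 0) (U.val.col 1) := by
      rw [pow_two]; exact mul_dvd_mul_left _ h2
    have h4 : (p : ℤ) ^ 2 ∣ p * q.polar (U.val.col 1) (U.val.col 0) := by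
      rwa [q.polar_comm]
    fin_cases i <;> fin_cases j <;> simp
    · exact h1
    · exact h3
    · exact h4
    · exact Dvd.dvd.mul_right (by rw [pow_two]) _
    · exact Dvd.dvd.mul_right (Dvd.intro_left _ rfl) _
    · exact Dvd.dvd.mul_right (Dvd.intro _ rfl) _
    · exact Dvd.dvd.mul_right (Dvd.intro _ rfl) _

/-! ### Reduction of `Ψ_A` modulo `p` -/

theorem pow_dvd_of_dvd_two_mul {p n : ℕ} (h2 : IsCoprime (p : ℤ) 2) {x : ℤ}
    (h : (p : ℤ) ^ n ∣ 2 * x) : (p : ℤ) ^ n ∣ x :=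
  h2.pow_left.dvd_of_dvd_mul_left h

theorem col_mul_D₃_mul (p : ℕ) (U V : Matrix (Fin 3) (Fin 3) ℤ) (j : Fin 3) :
    (U * D₃ p * V).col j = V 0 j • U.col 0 + (p * V 1 j) • U.col 1 +
      ((p : ℤ) ^ 2 * V 2 j) • U.col 2 := by
  ext i
  simp [D₃, Matrix.col_apply, Matrix.mul_apply, Fin.sum_univ_three, Matrix.diagonal]
  ring

/-- The cofactors along the third row of `V`. -/
def thirdMinors (V : Matrix (Fin 3) (Fin 3) ℤ) : Fin 4 → ℤ :=
  ![0, V 0 1 * V 1 2 - V 1 1 * V 0 2, -(V 0 0 * V 1 2 - V 1 0 * V 0 2),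
    V 0 0 * V 1 1 - V 1 0 * V 0 1]

theorem thirdMinors_dot (V : Matrix (Fin 3) (Fin 3) ℤ) :
    thirdMinors V ⬝ᵥ ![0, V 2 0, V 2 1, V 2 2] = V.det := by
  simp [thirdMinors, Matrix.det_fin_three, dotProduct, Fin.sum_univ_succ]
  ring

/-- Up to sign, the last three columns of `Φ_A` are `pairVec` of pairs of columns of `A`. By
`pairVec_expand` each is `p` times a minor of `V` times `w`, up to `p²`. The first column becomes
`p` times a basis vector, whence the `0` in `thirdMinors`. -/
theorem TernaryForm.Ψ_eq (q : TernaryForm) {p : ℕ} (hp : p ≠ 0) (h2 : IsCoprime (p : ℤ) 2)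
    (U V : Matrix (Fin 3) (Fin 3) ℤ) (hU : q.IsFrame p U) :
    ∃ P : Matrix (Fin 4) (Fin 4) ℤ, q.Ψ p (U * D₃ p * V) = P.map (Int.cast : ℤ → ℚ) ∧
      ∀ i j, (p : ℤ) ∣ P i j - q.pairVec (U.col 0) (U.col 1) i * thirdMinors V j := by
  have h0 : (p : ℚ) ≠ 0 := by exact_mod_cast hp
  obtain ⟨a, ha⟩ : (p : ℤ) ^ 2 ∣ U.col 0 ⬝ᵥ (q.Q₀ *ᵥ U.col 0) := by
    apply pow_dvd_of_dvd_two_mul h2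
    convert hU.1 using 1
    rw [TernaryForm.polar_eq]
    simp [TernaryForm.Q₀, Matrix.mulVec, dotProduct, Fin.sum_univ_three]
    ring
  obtain ⟨b, hb⟩ := hU.2
  set w := q.pairVec (U.col 0) (U.col 1) with hw
  have key : ∀ k l : Fin 3, ∃ r : Fin 4 → ℤ, ∀ i,
      q.pairVec ((U * D₃ p * V).col k) ((U * D₃ p * V).col l) i =
        p * ((V 0 k * V 1 l - V 1 k * V 0 l) * w i + p * r i) := fun k l => by
    obtain ⟨r, hr⟩ := q.pairVec_expand p a b (U.col 0) (U.col 1) (U.col 2)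
      (V.col k) (V.col l) ha hb
    exact ⟨r, fun i => by simpa [col_mul_D₃_mul] using hr i⟩
  set A := U * D₃ p * V with hA
  obtain ⟨r₁, h₁⟩ := key 1 2
  obtain ⟨r₂, h₂⟩ := key 0 2
  obtain ⟨r₃, h₃⟩ := key 0 1
  have hΦ : q.Φ A = Matrix.of fun i j => ![(![1, 0, 0, 0] : Fin 4 → ℤ) i, q.pairVec (A.col 1) (A.col 2) i,
      -q.pairVec (A.col 0) (A.col 2) i, q.pairVec (A.col 0) (A.col 1) i] j := by
    ext i j
    fin_cases i <;> fin_cases j <;>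
      simp [TernaryForm.Φ, TernaryForm.pairVec, TernaryForm.colPair, Matrix.adjugate_fin_three,
        Matrix.col_apply] <;> ring
  refine ⟨Matrix.of fun i j => ![(p : ℤ) * (![1, 0, 0, 0] : Fin 4 → ℤ) i,
    (V 0 1 * V 1 2 - V 1 1 * V 0 2) * w i + (p : ℤ) * r₁ i,
    -((V 0 0 * V 1 2 - V 1 0 * V 0 2) * w i + p * r₂ i),
    (V 0 0 * V 1 1 - V 1 0 * V 0 1) * w i + p * r₃ i] j, ?_, fun i j => ?_⟩
  · ext i j
    rw [TernaryForm.Ψ, hΦ, Matrix.mul_diagonal]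
    simp only [h₁, h₂, h₃, Matrix.map_apply, Matrix.of_apply]
    fin_cases j
    · simp [mul_comm]
    all_goals
      simp
      field_simp
      try ring
  · simp only [Matrix.of_apply, thirdMinors]
    fin_cases j <;> simp
    · exact ⟨r₁ i, by ring⟩
    · exact ⟨-r₂ i, by ring⟩
    · exact ⟨r₃ i, by ring⟩

theorem exists_dot_thirdMinors (V : GL (Fin 3) ℤ) :
    ∃ d : Fin 4 → ℤ, thirdMinors V.val ⬝ᵥ d = 1 := by
  have hV : IsUnit V.val.det := (Matrix.isUnit_iff_isUnit_det _).1 V.isUnit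
  obtain ⟨e, he⟩ := hV.exists_right_inv
  exact ⟨e • ![0, V.val 2 0, V.val 2 1, V.val 2 2], by
    rw [dotProduct_smul, thirdMinors_dot, smul_eq_mul, mul_comm, he]⟩

/-- A prime does not divide all entries of the cross product of two columns of a unimodular
matrix. -/
theorem not_forall_dvd_pairVec (q : TernaryForm) {p : ℕ} (hp : p.Prime) (U : GL (Fin 3) ℤ) :
    ¬ ∀ i : Fin 3, (p : ℤ) ∣ q.pairVec (U.val.col 0) (U.val.col 1) i.succ := fun h => by
  have hU : IsUnit U.val.det := (Matrix.isUnit_iff_isUnit_det _).1 U.isUnit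
  have : (p : ℤ) ∣ U.val.det := by
    have e : U.val.det = ∑ i : Fin 3,
        q.pairVec (U.val.col 0) (U.val.col 1) i.succ * U.val i 2 := by
      simp [TernaryForm.pairVec, Matrix.det_fin_three, Fin.sum_univ_three, Matrix.col_apply]
      ring
    rw [e]
    exact Finset.dvd_sum fun i _ => (h i).mul_right _
  exact (Nat.prime_iff_prime_int.1 hp).not_isUnit (isUnit_of_dvd_unit this hU)

/-- The reduction is an outer product that sends `d` to `w`, which is nonzero modulo `p`. -/
theorem rank_eq_one_of_congr {p : ℕ} (hp : p.Prime) (P : Matrix (Fin 4) (Fin 4) ℤ)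
    (w c d : Fin 4 → ℤ) (h : ∀ i j, (p : ℤ) ∣ P i j - w i * c j) (hc : c ⬝ᵥ d = 1)
    (hw : ∃ i, ¬ (p : ℤ) ∣ w i) : (P.map (Int.cast : ℤ → ZMod p)).rank = 1 := by
  have := Fact.mk hp
  have e : P.map (Int.cast : ℤ → ZMod p) =
      Matrix.vecMulVec (fun i => (w i : ZMod p)) (fun j => (c j : ZMod p)) := by
    ext i j
    have := (ZMod.intCast_zmod_eq_zero_iff_dvd _ p).2 (h i j)
    push_cast at this
    simpa [Matrix.vecMulVec_apply] using sub_eq_zero.1 this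
  rw [e]
  refine le_antisymm (Matrix.rank_vecMulVec_le _ _) ?_
  rw [Nat.one_le_iff_ne_zero]
  intro h0
  rw [Matrix.rank, Submodule.finrank_eq_zero, LinearMap.range_eq_bot] at h0
  obtain ⟨i, hi⟩ := hw
  apply hi
  have hcd : ∑ j, (c j : ZMod p) * d j = 1 := by
    simpa [dotProduct] using congrArg (Int.cast : ℤ → ZMod p) hc
  rw [← ZMod.intCast_zmod_eq_zero_iff_dvd]
  calc (w i : ZMod p) = w i * ∑ j, (c j : ZMod p) * d j := by rw [hcd, mul_one]
    _ = 0 := by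
      rw [Finset.mul_sum]
      simpa [Matrix.mulVec, dotProduct, Matrix.vecMulVec_apply, mul_assoc] using
        congrFun (LinearMap.congr_fun h0 fun j => (d j : ZMod p)) i

/-! ### Totally isotropic planes and the trace -/

/-- The vectors `x` and `y` are linearly dependent modulo `p`. -/
def Par {n : ℕ} (p : ℕ) (x y : Fin n → ℤ) : Prop := ∀ i j, (p : ℤ) ∣ x i * y j - x j * y i

theorem Par.mulVec {n m p : ℕ} {x y : Fin n → ℤ} (h : Par p x y)
    (T : Matrix (Fin m) (Fin n) ℤ) : Par p (T *ᵥ x) (T *ᵥ y) := fun i j => by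
  have : (T *ᵥ x) i * (T *ᵥ y) j - (T *ᵥ x) j * (T *ᵥ y) i =
      ∑ k, ∑ l, T i k * T j l * (x k * y l - x l * y k) := by
    have e : (T *ᵥ x) j * (T *ᵥ y) i = ∑ k, ∑ l, T i k * T j l * (x l * y k) := by
      rw [mul_comm]
      simp only [Matrix.mulVec, dotProduct, Finset.sum_mul_sum]
      exact Finset.sum_congr rfl fun k _ => Finset.sum_congr rfl fun l _ => by ring
    rw [e]
    simp only [Matrix.mulVec, dotProduct, Finset.sum_mul_sum, ← Finset.sum_sub_distrib]
    exact Finset.sum_congr rfl fun k _ => Finset.sum_congr rfl fun l _ => by ring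
  rw [this]
  exact Finset.dvd_sum fun k _ => Finset.dvd_sum fun l _ => (h k l).mul_left _

theorem dotProduct_transform {n : ℕ} (L U : Matrix (Fin n) (Fin n) ℤ) (x y : Fin n → ℤ) :
    (U *ᵥ x) ⬝ᵥ (L *ᵥ (U *ᵥ y)) = x ⬝ᵥ (transform L U *ᵥ y) := by
  rw [transform, ← Matrix.mulVec_mulVec, ← Matrix.mulVec_mulVec, Matrix.dotProduct_mulVec x,
    Matrix.vecMul_transpose]

theorem inv_mulVec_mulVec {n : ℕ} (U : GL (Fin n) ℤ) (x : Fin n → ℤ) :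
    (U⁻¹).val *ᵥ (U.val *ᵥ x) = x := by
  rw [Matrix.mulVec_mulVec, ← Units.val_mul, inv_mul_cancel, Units.val_one, Matrix.one_mulVec]

theorem mulVec_inv_mulVec {n : ℕ} (U : GL (Fin n) ℤ) (x : Fin n → ℤ) :
    U.val *ᵥ ((U⁻¹).val *ᵥ x) = x := by
  simp

theorem dvd_mulVec {m n : ℕ} {a : ℤ} {x : Fin n → ℤ} (h : ∀ i, a ∣ x i)
    (T : Matrix (Fin m) (Fin n) ℤ) (i : Fin m) : a ∣ (T *ᵥ x) i := by
  rw [Matrix.mulVec, dotProduct]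
  exact Finset.dvd_sum fun k _ => (h k).mul_left _

theorem isUnit_det_GL {n : ℕ} (U : GL (Fin n) ℤ) : IsUnit U.val.det :=
  (Matrix.isUnit_iff_isUnit_det _).1 U.isUnit

theorem not_dvd_det_GL {p n : ℕ} (hp : p.Prime) (U : GL (Fin n) ℤ) : ¬ (p : ℤ) ∣ U.val.det :=
  fun h => (Nat.prime_iff_prime_int.1 hp).not_isUnit (isUnit_of_dvd_unit h (isUnit_det_GL U))

/-- A totally isotropic plane in a nondegenerate symmetric space of dimension four is its own
orthogonal complement. -/
theorem dotProduct_mulVec_eq_zero_of_orthogonal {K : Type*} [Field K]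
    (n : Matrix (Fin 4) (Fin 4) K) (hs : nᵀ = n) (h00 : n 0 0 = 0) (h01 : n 0 1 = 0)
    (h11 : n 1 1 = 0) (hdet : n.det ≠ 0) (c : Fin 4 → K) (h0 : (n *ᵥ c) 0 = 0)
    (h1 : (n *ᵥ c) 1 = 0) : c ⬝ᵥ (n *ᵥ c) = 0 := by
  have s : ∀ i j, n j i = n i j := fun i j => congrFun (congrFun hs i) j
  -- With a zero upper left block, the determinant is the square of the off-diagonal `2 × 2` minor;
  -- Cramer's rule then kills `c 2` and `c 3`.
  have hk : n.det = (n 0 2 * n 1 3 - n 0 3 * n 1 2) ^ 2 := by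
    simp [Matrix.det_succ_row_zero, Fin.sum_univ_succ, Fin.succAbove, s 0 1, s 0 2, s 0 3, s 1 2,
      s 1 3, s 2 3, h00, h01, h11]
    ring
  have hk0 : n 0 2 * n 1 3 - n 0 3 * n 1 2 ≠ 0 := fun h => hdet (by rw [hk, h]; simp)
  simp only [Matrix.mulVec, dotProduct, Fin.sum_univ_four, s 0 1, h00, h01, h11] at h0 h1
  have c2 : c 2 = 0 := (mul_eq_zero.1 (by linear_combination n 1 3 * h0 - n 0 3 * h1 :
    (n 0 2 * n 1 3 - n 0 3 * n 1 2) * c 2 = 0)).resolve_left hk0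
  have c3 : c 3 = 0 := (mul_eq_zero.1 (by linear_combination n 0 2 * h1 - n 1 2 * h0 :
    (n 0 2 * n 1 3 - n 0 3 * n 1 2) * c 3 = 0)).resolve_left hk0
  simp [Matrix.mulVec, dotProduct, Fin.sum_univ_four, s 0 1, h00, h01, h11, c2, c3]

theorem TernaryForm.trace_mulVec (q : TernaryForm) (U : Matrix (Fin 4) (Fin 4) ℤ)
    (x : Fin 4 → ℤ) : q.trace (U *ᵥ x) = ∑ i, x i * q.trace (U.col i) := by
  simp [TernaryForm.trace, Matrix.mulVec, dotProduct, Fin.sum_univ_four, Matrix.col_apply]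
  ring

/-- The first two columns of `U` span a totally isotropic plane modulo `p`. -/
def TernaryForm.IsIsotropic (q : TernaryForm) (p : ℕ) (U : Matrix (Fin 4) (Fin 4) ℤ) : Prop :=
  (p : ℤ) ∣ transform q.N U 0 0 ∧ (p : ℤ) ∣ transform q.N U 0 1 ∧ (p : ℤ) ∣ transform q.N U 1 1

theorem transform_transpose {n : ℕ} {L : Matrix (Fin n) (Fin n) ℤ} (h : Lᵀ = L)
    (U : Matrix (Fin n) (Fin n) ℤ) : (transform L U)ᵀ = transform L U := by
  simp [transform, Matrix.transpose_mul, h, Matrix.mul_assoc]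

theorem not_dvd_two {q : TernaryForm} {p : ℕ} (hd : ¬ (p : ℤ) ∣ q.Q.det) : ¬ (p : ℤ) ∣ 2 :=
  fun h => hd (by rw [q.det_Q]; exact h.mul_right _)

/-- A totally isotropic plane contains elements of nonzero trace. -/
theorem TernaryForm.IsIsotropic.not_dvd_trace {q : TernaryForm} {p : ℕ} (hp : p.Prime)
    (hd : ¬ (p : ℤ) ∣ q.Q.det) {U : GL (Fin 4) ℤ} (hU : q.IsIsotropic p U.val) :
    ¬ ((p : ℤ) ∣ q.trace (U.val.col 0) ∧ (p : ℤ) ∣ q.trace (U.val.col 1)) := by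
  rintro ⟨h0, h1⟩
  have := Fact.mk hp
  have hp' := Nat.prime_iff_prime_int.1 hp
  -- These are the coordinates of `1` in the basis of columns of `U`. If both traces vanish, `1` is
  -- orthogonal to the plane, so its value `2` must vanish modulo `p`.
  set c : Fin 4 → ℤ := (U⁻¹).val *ᵥ ![1, 0, 0, 0] with hc
  have hUc : U.val *ᵥ c = ![1, 0, 0, 0] := mulVec_inv_mulVec U _
  have hcc : c ⬝ᵥ (transform q.N U.val *ᵥ c) = 2 := by
    rw [← dotProduct_transform, hUc]
    simp [TernaryForm.N, Matrix.mulVec, dotProduct, Fin.sum_univ_four]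
  have htr : ∀ i, (transform q.N U.val *ᵥ c) i = q.trace (U.val.col i) := fun i => by
    rw [transform, ← Matrix.mulVec_mulVec, hUc, ← Matrix.mulVec_mulVec, TernaryForm.trace_eq]
    nth_rw 2 [← q.N_transpose]
    simp [Matrix.mulVec, dotProduct, Fin.sum_univ_four, Matrix.col_apply]
    ring
  let f := Int.castRingHom (ZMod p)
  have hf : ∀ x : ℤ, (p : ℤ) ∣ x ↔ f x = 0 := fun x =>
    (ZMod.intCast_zmod_eq_zero_iff_dvd x p).symm
  have hm : ∀ i, (((transform q.N U.val).map f) *ᵥ (f ∘ c)) i =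
      f ((transform q.N U.val *ᵥ c) i) := fun i => (RingHom.map_mulVec f _ _ i).symm
  have key := dotProduct_mulVec_eq_zero_of_orthogonal ((transform q.N U.val).map f)
    (by rw [← Matrix.transpose_map, transform_transpose q.N_transpose])
    ((hf _).1 hU.1) ((hf _).1 hU.2.1) ((hf _).1 hU.2.2)
    (by
      rw [← RingHom.mapMatrix_apply, ← RingHom.map_det]
      intro h
      rw [← hf, transform, Matrix.det_mul, Matrix.det_mul, Matrix.det_transpose, q.det_N] at h
      have hh : ¬ (p : ℤ) ∣ q.halfDisc := fun h => hd (by rw [q.det_Q]; exact h.mul_left _)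
      rcases hp'.dvd_or_dvd h with h | h
      · rcases hp'.dvd_or_dvd h with h | h
        · exact not_dvd_det_GL hp U h
        · exact hh (hp'.dvd_of_dvd_pow h)
      · exact not_dvd_det_GL hp U h)
    (f ∘ c) (by rw [hm, htr]; exact (hf _).1 h0) (by rw [hm, htr]; exact (hf _).1 h1)
  have : f (c ⬝ᵥ (transform q.N U.val *ᵥ c)) = 0 := by
    rw [RingHom.map_dotProduct, ← key]
    congr 1
    ext i
    exact (hm i).symm
  rw [hcc, ← hf] at this
  exact not_dvd_two hd this

/-- The vector `w` lies, modulo `p`, in the span of the first two columns of `U`. -/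
def InPlane (p : ℕ) (U : GL (Fin 4) ℤ) (w : Fin 4 → ℤ) : Prop :=
  (p : ℤ) ∣ ((U⁻¹).val *ᵥ w) 2 ∧ (p : ℤ) ∣ ((U⁻¹).val *ᵥ w) 3

theorem InPlane.dvd_trace {q : TernaryForm} {p : ℕ} {U : GL (Fin 4) ℤ} {w : Fin 4 → ℤ}
    (hw : InPlane p U w) (ht : (p : ℤ) ∣ q.trace w) :
    (p : ℤ) ∣ ((U⁻¹).val *ᵥ w) 0 * q.trace (U.val.col 0) +
      ((U⁻¹).val *ᵥ w) 1 * q.trace (U.val.col 1) := by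
  rw [← mulVec_inv_mulVec U w, q.trace_mulVec, Fin.sum_univ_four, add_assoc] at ht
  exact (dvd_add_left (dvd_add (hw.1.mul_right _) (hw.2.mul_right _))).1 ht

/-- The trace zero part of a totally isotropic plane is at most a line. -/
theorem TernaryForm.IsIsotropic.par {q : TernaryForm} {p : ℕ} (hp : p.Prime)
    (hd : ¬ (p : ℤ) ∣ q.Q.det) {U : GL (Fin 4) ℤ} (hU : q.IsIsotropic p U.val) {w w' : Fin 4 → ℤ}
    (hw : InPlane p U w) (ht : (p : ℤ) ∣ q.trace w) (hw' : InPlane p U w')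
    (ht' : (p : ℤ) ∣ q.trace w') : Par p w w' := by
  have hp' := Nat.prime_iff_prime_int.1 hp
  have e := hw.dvd_trace ht
  have e' := hw'.dvd_trace ht'
  have hn := hU.not_dvd_trace hp hd
  rw [← mulVec_inv_mulVec U w, ← mulVec_inv_mulVec U w']
  apply Par.mulVec
  obtain ⟨h2, h3⟩ := hw
  obtain ⟨h2', h3'⟩ := hw'
  set x := (U⁻¹).val *ᵥ w
  set y := (U⁻¹).val *ᵥ w'
  -- Both coordinate pairs are killed by the trace functional; a nonzero determinant would make that
  -- functional vanish on the plane.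
  have h01 : (p : ℤ) ∣ x 0 * y 1 - x 1 * y 0 := by
    by_contra h
    refine hn ⟨(hp'.dvd_or_dvd (?_ : (p : ℤ) ∣
      (x 0 * y 1 - x 1 * y 0) * q.trace (U.val.col 0))).resolve_left h,
      (hp'.dvd_or_dvd (?_ : (p : ℤ) ∣
      (x 0 * y 1 - x 1 * y 0) * q.trace (U.val.col 1))).resolve_left h⟩
    · obtain ⟨a, ha⟩ := e
      obtain ⟨b, hb⟩ := e'
      exact ⟨y 1 * a - x 1 * b, by linear_combination y 1 * ha - x 1 * hb⟩
    · obtain ⟨a, ha⟩ := e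
      obtain ⟨b, hb⟩ := e'
      exact ⟨x 0 * b - y 0 * a, by linear_combination x 0 * hb - y 0 * ha⟩
  have aux : ∀ {a b c d : ℤ}, (p : ℤ) ∣ a → (p : ℤ) ∣ b → (p : ℤ) ∣ c * b - a * d :=
    fun ha hb => dvd_sub (hb.mul_left _) (ha.mul_right _)
  have aux' : ∀ {a b c d : ℤ}, (p : ℤ) ∣ a → (p : ℤ) ∣ b → (p : ℤ) ∣ a * c - d * b :=
    fun ha hb => dvd_sub (ha.mul_right _) (hb.mul_left _)
  intro i j
  fin_cases i <;> fin_cases j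
  all_goals first
    | exact h01
    | exact dvd_sub_comm.1 h01
    | exact aux h2 h2'
    | exact aux h3 h3'
    | exact aux' h2 h2'
    | exact aux' h3 h3'
    | simp

/-- A totally isotropic plane contains a nonzero element of trace zero. -/
theorem TernaryForm.IsIsotropic.exists_trace_eq_zero {q : TernaryForm} {p : ℕ} (hp : p.Prime)
    (hd : ¬ (p : ℤ) ∣ q.Q.det) {U : GL (Fin 4) ℤ} (hU : q.IsIsotropic p U.val) :
    ∃ w : Fin 4 → ℤ, InPlane p U w ∧ q.trace w = 0 ∧ (p : ℤ) ∣ w ⬝ᵥ (q.N *ᵥ w) ∧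
      ¬ ∀ i, (p : ℤ) ∣ w i := by
  -- The kernel of the trace functional on the plane.
  set x : Fin 4 → ℤ := ![q.trace (U.val.col 1), -q.trace (U.val.col 0), 0, 0] with hx
  refine ⟨U.val *ᵥ x, ?_, ?_, ?_, fun h => ?_⟩
  · rw [InPlane, inv_mulVec_mulVec]
    simp [hx]
  · rw [q.trace_mulVec, Fin.sum_univ_four]
    simp [hx]
    ring
  · rw [dotProduct_transform]
    have s : transform q.N U.val 1 0 = transform q.N U.val 0 1 :=
      congrFun (congrFun (transform_transpose q.N_transpose U.val) 0) 1
    have e : x ⬝ᵥ (transform q.N U.val *ᵥ x) = transform q.N U.val 0 0 * (x 0 * x 0) +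
        transform q.N U.val 0 1 * (2 * x 0 * x 1) + transform q.N U.val 1 1 * (x 1 * x 1) := by
      simp [Matrix.mulVec, dotProduct, Fin.sum_univ_four, hx, s]
      ring
    rw [e]
    exact dvd_add (dvd_add (hU.1.mul_right _) (hU.2.1.mul_right _)) (hU.2.2.mul_right _)
  · have h' := fun i => dvd_mulVec h (U⁻¹).val i
    rw [inv_mulVec_mulVec] at h'
    exact hU.not_dvd_trace hp hd ⟨by simpa [hx] using h' 1, by simpa [hx] using h' 0⟩

theorem TernaryForm.isIsotropic_of_congZero {q : TernaryForm} {p : ℕ} (U V : GL (Fin 4) ℤ)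
    (h : CongZero p (transform q.N (U.val * D₄ p * V.val))) : q.IsIsotropic p U.val := by
  rw [congZero_transform_mul_unit] at h
  have e : ∀ i j, transform q.N (U.val * D₄ p) i j =
      ![1, 1, (p : ℤ), (p : ℤ)] i * transform q.N U.val i j * ![1, 1, (p : ℤ), (p : ℤ)] j := by
    intro i j
    rw [transform_mul, D₄, transform, Matrix.mul_diagonal, Matrix.diagonal_transpose, Matrix.diagonal_mul]
  exact ⟨by simpa [e] using h 0 0, by simpa [e] using h 0 1, by simpa [e] using h 1 1⟩

/-- Divisibility by `U D₄ V` asks that the last two rows of `U⁻¹ P` vanish modulo `p`. These rows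
are multiples of `c` by coordinates of `U⁻¹ w`, and `c` is primitive. -/
theorem leftDivides_iff_inPlane {p : ℕ} (U V : GL (Fin 4) ℤ) (P : Matrix (Fin 4) (Fin 4) ℤ)
    {w c d : Fin 4 → ℤ} (h : ∀ i j, (p : ℤ) ∣ P i j - w i * c j) (hc : c ⬝ᵥ d = 1) :
    LeftDivides (U.val * D₄ p * V.val) (P.map (Int.cast : ℤ → ℚ)) ↔ InPlane p U w := by
  have hcong : ∀ i j, (p : ℤ) ∣ ((U⁻¹).val * P) i j - ((U⁻¹).val *ᵥ w) i * c j := fun i j => by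
    simp only [Matrix.mul_apply, Matrix.mulVec, dotProduct, Finset.sum_mul,
      ← Finset.sum_sub_distrib]
    refine Finset.dvd_sum fun k _ => ?_
    convert (h k j).mul_left ((U⁻¹).val i k) using 1
    ring
  have hrow : ∀ i, (p : ℤ) ∣ ((U⁻¹).val *ᵥ w) i ↔ ∀ j, (p : ℤ) ∣ ((U⁻¹).val * P) i j := fun i => by
    constructor
    · intro hi j
      exact (dvd_iff_dvd_of_dvd_sub (hcong i j)).2 (hi.mul_right _)
    · intro hi
      have : ((U⁻¹).val *ᵥ w) i = ∑ j, ((U⁻¹).val *ᵥ w) i * c j * d j := by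
        simp only [mul_assoc, ← Finset.mul_sum]
        rw [dotProduct] at hc
        rw [hc, mul_one]
      rw [this]
      exact Finset.dvd_sum fun j _ =>
        ((dvd_iff_dvd_of_dvd_sub (hcong i j)).1 (hi j)).mul_right _
  rw [InPlane, hrow, hrow]
  constructor
  · rintro ⟨X, hX⟩
    have hPX : P = U.val * D₄ p * V.val * X :=
      Matrix.map_injective Int.cast_injective hX
    have e : (U⁻¹).val * P = D₄ p * (V.val * X) := by
      rw [hPX, Matrix.mul_assoc, Matrix.mul_assoc U.val, ← Matrix.mul_assoc (U⁻¹).val,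
        ← Units.val_mul, inv_mul_cancel, Units.val_one, Matrix.one_mul]
    rw [e, D₄]
    exact ⟨fun j => by rw [Matrix.diagonal_mul]; exact Dvd.intro _ rfl,
      fun j => by rw [Matrix.diagonal_mul]; exact Dvd.intro _ rfl⟩
  · rintro ⟨h2, h3⟩
    choose r hr using h2
    choose s hs using h3
    set Y : Matrix (Fin 4) (Fin 4) ℤ :=
      Matrix.of ![((U⁻¹).val * P) 0, ((U⁻¹).val * P) 1, r, s] with hY
    have e : (U⁻¹).val * P = D₄ p * Y := by
      ext i j
      rw [D₄, Matrix.diagonal_mul]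
      fin_cases i
      · simp [hY]
      · simp [hY]
      · simpa [hY] using hr j
      · simpa [hY] using hs j
    refine ⟨(V⁻¹).val * Y, ?_⟩
    congr 1
    rw [Matrix.mul_assoc, ← Matrix.mul_assoc V.val, ← Units.val_mul, mul_inv_cancel,
      Units.val_one, Matrix.one_mul, Matrix.mul_assoc, ← e, ← Matrix.mul_assoc, ← Units.val_mul,
      mul_inv_cancel, Units.val_one, Matrix.one_mul]

/-! ### A frame coset is determined by its line -/

theorem TernaryForm.not_forall_dvd_polar (q : TernaryForm) {p : ℕ} (hp : p.Prime)
    (hd : ¬ (p : ℤ) ∣ q.Q.det) (U : GL (Fin 3) ℤ) :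
    ¬ ∀ i, (p : ℤ) ∣ q.polar (U.val.col 0) (U.val.col i) := fun h => by
  have hp' := Nat.prime_iff_prime_int.1 hp
  have h' : (p : ℤ) ∣ (transform q.Q U.val).det := by
    rw [Matrix.det_succ_row_zero]
    refine Finset.dvd_sum fun i _ => ?_
    rw [q.transform_Q_apply]
    exact ((h i).mul_left _).mul_right _
  rw [transform, Matrix.det_mul, Matrix.det_mul, Matrix.det_transpose] at h'
  rcases hp'.dvd_or_dvd h' with h | h
  · exact (hp'.dvd_or_dvd h).elim (not_dvd_det_GL hp U) hd
  · exact not_dvd_det_GL hp U h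

theorem TernaryForm.IsFrame.not_dvd {q : TernaryForm} {p : ℕ} (hp : p.Prime)
    (hd : ¬ (p : ℤ) ∣ q.Q.det) {U : GL (Fin 3) ℤ} (hU : q.IsFrame p U.val) :
    ¬ (p : ℤ) ∣ q.polar (U.val.col 0) (U.val.col 2) := fun h =>
  q.not_forall_dvd_polar hp hd U fun i => by
    fin_cases i
    · exact (dvd_pow_self _ two_ne_zero).trans hU.1
    · exact hU.2
    · exact h

/-- Modulo `p`, `u` is orthogonal to `u` and `v`, so only the cross product of `u` and `v` survives
in the dual basis expansion of `Q u`. -/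
theorem TernaryForm.IsFrame.dvd_sub {q : TernaryForm} {p : ℕ} {U : Matrix (Fin 3) (Fin 3) ℤ}
    (hU : q.IsFrame p U) (i : Fin 3) :
    (p : ℤ) ∣ U.det * (q.Q *ᵥ U.col 0) i -
      q.polar (U.col 0) (U.col 2) * q.pairVec (U.col 0) (U.col 1) i.succ := by
  rw [q.det_smul_mulVec, add_sub_cancel_right]
  exact dvd_add (((dvd_pow_self _ two_ne_zero).trans hU.1).mul_right _) (hU.2.mul_right _)

theorem adjugate_mulVec_mulVec {n : ℕ} (T : Matrix (Fin n) (Fin n) ℤ) (x : Fin n → ℤ)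
    (i : Fin n) : (T.adjugate *ᵥ (T *ᵥ x)) i = T.det * x i := by
  rw [Matrix.mulVec_mulVec, Matrix.adjugate_mul, Matrix.smul_mulVec, Matrix.one_mulVec]; rfl

theorem mulVec_adjugate_mulVec {n : ℕ} (T : Matrix (Fin n) (Fin n) ℤ) (x : Fin n → ℤ)
    (i : Fin n) : (T *ᵥ (T.adjugate *ᵥ x)) i = T.det * x i := by
  rw [Matrix.mulVec_mulVec, Matrix.mul_adjugate, Matrix.smul_mulVec, Matrix.one_mulVec]; rfl

theorem TernaryForm.IsFrame.par {q : TernaryForm} {p : ℕ} (hp : p.Prime)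
    (hd : ¬ (p : ℤ) ∣ q.Q.det) {U U' : GL (Fin 3) ℤ} (hU : q.IsFrame p U.val)
    (hU' : q.IsFrame p U'.val)
    (h : Par p (q.pairVec (U.val.col 0) (U.val.col 1)) (q.pairVec (U'.val.col 0) (U'.val.col 1))) :
    Par p (U.val.col 0) (U'.val.col 0) := by
  have hp' := Nat.prime_iff_prime_int.1 hp
  have h1 : Par p (q.Q *ᵥ U.val.col 0) (q.Q *ᵥ U'.val.col 0) := fun i j => by
    obtain ⟨a, ha⟩ := hU.dvd_sub i
    obtain ⟨b, hb⟩ := hU.dvd_sub j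
    obtain ⟨a', ha'⟩ := hU'.dvd_sub i
    obtain ⟨b', hb'⟩ := hU'.dvd_sub j
    obtain ⟨e, he⟩ := h i.succ j.succ
    rw [sub_eq_iff_eq_add] at ha hb ha' hb'
    have key : (p : ℤ) ∣ U.val.det * U'.val.det * ((q.Q *ᵥ U.val.col 0) i *
        (q.Q *ᵥ U'.val.col 0) j - (q.Q *ᵥ U.val.col 0) j * (q.Q *ᵥ U'.val.col 0) i) := by
      have : U.val.det * U'.val.det * ((q.Q *ᵥ U.val.col 0) i *
          (q.Q *ᵥ U'.val.col 0) j - (q.Q *ᵥ U.val.col 0) j * (q.Q *ᵥ U'.val.col 0) i) =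
          (U.val.det * (q.Q *ᵥ U.val.col 0) i) * (U'.val.det * (q.Q *ᵥ U'.val.col 0) j) -
          (U.val.det * (q.Q *ᵥ U.val.col 0) j) * (U'.val.det * (q.Q *ᵥ U'.val.col 0) i) := by
        ring
      rw [this, ha, hb, ha', hb']
      set k := q.polar (U.val.col 0) (U.val.col 2)
      set k' := q.polar (U'.val.col 0) (U'.val.col 2)
      set W := q.pairVec (U.val.col 0) (U.val.col 1)
      set W' := q.pairVec (U'.val.col 0) (U'.val.col 1)
      exact ⟨a * (p * b' + k' * W' j.succ) + k * W i.succ * b' - b * (p * a' + k' * W' i.succ) -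
        k * W j.succ * a' + k * k' * e, by linear_combination k * k' * he⟩
    exact ((hp'.dvd_or_dvd key).resolve_left fun h => (hp'.dvd_or_dvd h).elim
      (not_dvd_det_GL hp U) (not_dvd_det_GL hp U'))
  intro i j
  have h2 := h1.mulVec q.Q.adjugate i j
  simp only [adjugate_mulVec_mulVec] at h2
  refine (hp'.dvd_or_dvd ((hp'.dvd_or_dvd (?_ : (p : ℤ) ∣ q.Q.det * (q.Q.det * _))).resolve_left
    hd)).resolve_left hd
  convert h2 using 1
  ring

/-- With `U' = U G`, the claim is that `D₃⁻¹ G D₃` is integral: `p` divides `G 1 0` and `G 2 1`, and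
`p²` divides `G 2 0`. Proportionality gives `p` in the first column; the frame conditions on `U'`
give the rest. -/
theorem TernaryForm.IsFrame.mem_coset {q : TernaryForm} {p : ℕ} (hp : p.Prime)
    (hd : ¬ (p : ℤ) ∣ q.Q.det) {U U' : GL (Fin 3) ℤ} (hU : q.IsFrame p U.val)
    (hU' : q.IsFrame p U'.val) (h : Par p (U.val.col 0) (U'.val.col 0)) :
    U'.val * D₃ p ∈ coset (U.val * D₃ p) := by
  have hp' := Nat.prime_iff_prime_int.1 hp
  have h0 : (p : ℤ) ≠ 0 := hp'.ne_zero
  obtain ⟨G, hG⟩ : ∃ G : GL (Fin 3) ℤ, U' = U * G := ⟨U⁻¹ * U', by simp⟩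
  have hG' : U'.val = U.val * G.val := by rw [hG]; rfl
  have hcol : ∀ i, U'.val.col i = U.val *ᵥ G.val.col i := fun i => by
    ext k; rw [hG']; rfl
  have hcol0 : U.val.col 0 = U.val *ᵥ ![1, 0, 0] := by
    ext k; simp [Matrix.mulVec, dotProduct, Fin.sum_univ_three]
  rw [hcol0, hcol] at h
  have h2 := h.mulVec (U⁻¹).val
  rw [inv_mulVec_mulVec, inv_mulVec_mulVec] at h2
  have g1 : (p : ℤ) ∣ G.val 1 0 := by simpa using h2 0 1
  have g2 : (p : ℤ) ∣ G.val 2 0 := by simpa using h2 0 2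
  have g0 : ¬ (p : ℤ) ∣ G.val 0 0 := fun g0 => by
    apply not_dvd_det_GL hp G
    rw [Matrix.det_fin_three]
    obtain ⟨a, ha⟩ := g0
    obtain ⟨b, hb⟩ := g1
    obtain ⟨c, hc⟩ := g2
    rw [ha, hb, hc]
    exact ⟨a * G.val 1 1 * G.val 2 2 - a * G.val 1 2 * G.val 2 1 - G.val 0 1 * b * G.val 2 2 +
      G.val 0 1 * G.val 1 2 * c + G.val 0 2 * b * G.val 2 1 - G.val 0 2 * G.val 1 1 * c, by ring⟩
  have hk := hU.not_dvd hp hd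
  have hpol : ∀ x y : Fin 3 → ℤ, q.polar (U.val *ᵥ x) (U.val *ᵥ y) =
      ∑ i, ∑ j, x i * y j * q.polar (U.val.col i) (U.val.col j) := fun x y => by
    rw [TernaryForm.polar, dotProduct_transform]
    simp only [← q.transform_Q_apply, dotProduct, Matrix.mulVec, Finset.mul_sum]
    exact Finset.sum_congr rfl fun i _ => Finset.sum_congr rfl fun j _ => by ring
  obtain ⟨b, hb⟩ := g1
  obtain ⟨c, hc⟩ := g2
  obtain ⟨⟨m, hm⟩, ⟨n, hn⟩⟩ := hU
  obtain ⟨h00, h01⟩ := hU'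
  rw [hcol, hpol] at h00
  rw [hcol, hcol, hpol] at h01
  simp only [Fin.sum_univ_three, Matrix.col_apply, q.polar_comm (U.val.col 1) (U.val.col 0),
    q.polar_comm (U.val.col 2) (U.val.col 0), q.polar_comm (U.val.col 2) (U.val.col 1), hm, hn,
    hb, hc] at h00 h01
  -- Modulo `p²` the value `q.polar u' u'` reduces to `2 p (G 0 0) c k`, where `k` pairs `u` with
  -- the third column of `U` and is prime to `p`.
  have hc' : (p : ℤ) ∣ c := by
    obtain ⟨e, he⟩ := h00
    have : (p : ℤ) ∣ 2 * (G.val 0 0 * (q.polar (U.val.col 0) (U.val.col 2) * c)) := by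
      set k := q.polar (U.val.col 0) (U.val.col 2)
      refine ⟨e - (G.val 0 0 ^ 2 * m + 2 * G.val 0 0 * b * n +
        b ^ 2 * q.polar (U.val.col 1) (U.val.col 1) +
        2 * b * c * q.polar (U.val.col 1) (U.val.col 2) +
        c ^ 2 * q.polar (U.val.col 2) (U.val.col 2)), ?_⟩
      apply mul_left_cancel₀ h0
      linear_combination he
    exact (hp'.dvd_or_dvd ((hp'.dvd_or_dvd ((hp'.dvd_or_dvd this).resolve_left
      (not_dvd_two hd))).resolve_left g0)).resolve_left hk
  have hd' : (p : ℤ) ∣ G.val 2 1 := by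
    obtain ⟨e, he⟩ := h01
    have : (p : ℤ) ∣ G.val 0 0 * (q.polar (U.val.col 0) (U.val.col 2) * G.val 2 1) := by
      refine ⟨e - (G.val 0 0 * G.val 0 1 * p * m + G.val 0 0 * G.val 1 1 * n +
        b * (G.val 0 1 * (p * n) + G.val 1 1 * q.polar (U.val.col 1) (U.val.col 1) +
          G.val 2 1 * q.polar (U.val.col 1) (U.val.col 2)) +
        c * (G.val 0 1 * q.polar (U.val.col 0) (U.val.col 2) +
          G.val 1 1 * q.polar (U.val.col 1) (U.val.col 2) +
          G.val 2 1 * q.polar (U.val.col 2) (U.val.col 2))), ?_⟩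
      linear_combination he
    exact (hp'.dvd_or_dvd ((hp'.dvd_or_dvd this).resolve_left g0)).resolve_left hk
  obtain ⟨c', rfl⟩ := hc'
  obtain ⟨f, hf⟩ := hd'
  -- This is `D₃⁻¹ G D₃`.
  set X : Matrix (Fin 3) (Fin 3) ℤ := !![G.val 0 0, p * G.val 0 1, p ^ 2 * G.val 0 2;
    b, G.val 1 1, p * G.val 1 2; c', f, G.val 2 2] with hX
  have hGX : G.val * D₃ p = D₃ p * X := by
    ext i j
    rw [D₃, Matrix.mul_diagonal, Matrix.diagonal_mul]
    fin_cases i <;> fin_cases j <;> simp [hX, hb, hc, hf] <;> ring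
  have hdet : X.det = G.val.det := by
    have h3 : (D₃ p).det ≠ 0 := by
      simp [D₃, Matrix.det_diagonal, Fin.prod_univ_three, hp.ne_zero]
    have := congrArg Matrix.det hGX
    rw [Matrix.det_mul, Matrix.det_mul, mul_comm] at this
    exact (mul_left_cancel₀ h3 this).symm
  obtain ⟨Y, hY⟩ := (Matrix.isUnit_iff_isUnit_det X).2 (hdet ▸ isUnit_det_GL G)
  exact ⟨Y, by rw [hG', Matrix.mul_assoc, hGX, hY, Matrix.mul_assoc]⟩

/-! ### Existence of a frame -/

/-- A primitive vector which is isotropic modulo `p` lifts to the first column of a frame. -/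
theorem TernaryForm.exists_isFrame (q : TernaryForm) {p : ℕ} (hp : p.Prime)
    (hd : ¬ (p : ℤ) ∣ q.Q.det) (U₀ : GL (Fin 3) ℤ)
    (h : (p : ℤ) ∣ q.polar (U₀.val.col 0) (U₀.val.col 0)) :
    ∃ U : GL (Fin 3) ℤ, q.IsFrame p U.val ∧ ∀ i, (p : ℤ) ∣ U.val i 0 - U₀.val i 0 := by
  have hp' := Nat.prime_iff_prime_int.1 hp
  obtain ⟨g, b, c, s, t, hb, hc, hst⟩ := exists_gcd_factor
    (q.polar (U₀.val.col 0) (U₀.val.col 1)) (q.polar (U₀.val.col 0) (U₀.val.col 2))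
  have hg : ¬ (p : ℤ) ∣ 2 * g := fun hg => by
    have hg := (hp'.dvd_or_dvd hg).resolve_left (not_dvd_two hd)
    refine q.not_forall_dvd_polar hp hd U₀ fun i => ?_
    fin_cases i
    · exact h
    · simp only [Fin.mk_one]; rw [hb]; exact hg.mul_right _
    · simp only [Fin.reduceFinMk]; rw [hc]; exact hg.mul_right _
  obtain ⟨a, ha⟩ := h
  obtain ⟨x, y, hxy⟩ := (hp'.coprime_iff_not_dvd).2 hg
  -- Write `u₀, u₁, u₂` for the columns of `U₀`. The vector `z = s u₁ + t u₂` pairs with `u₀` to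
  -- `g`, and `c u₁ - b u₂` is orthogonal to `u₀`. As `y` inverts `2 g` modulo `p`, the Hensel
  -- correction `u₀ - p a y z` removes the term `p a` modulo `p²`.
  set G : Matrix (Fin 3) (Fin 3) ℤ :=
    !![1, 0, 0; p * (-a * y) * s, c, s; p * (-a * y) * t, -b, t] with hG
  have hdet : G.det = 1 := by
    simp [hG, Matrix.det_fin_three]
    linear_combination hst
  obtain ⟨Y, hY⟩ := (Matrix.isUnit_iff_isUnit_det G).2 (hdet ▸ isUnit_one)
  have c0 : (U₀ * Y).val.col 0 = U₀.val.col 0 + (p * (-a * y) * s) • U₀.val.col 1 +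
      (p * (-a * y) * t) • U₀.val.col 2 := by
    ext i
    simp [hY, hG, Matrix.mul_apply, Fin.sum_univ_three, Matrix.col_apply]
    ring
  have c1 : (U₀ * Y).val.col 1 = c • U₀.val.col 1 + (-b) • U₀.val.col 2 := by
    ext i
    simp [hY, hG, Matrix.mul_apply, Fin.sum_univ_three, Matrix.col_apply]
    ring
  refine ⟨U₀ * Y, ⟨?_, ?_⟩, fun i => ?_⟩
  · rw [c0]
    refine ⟨x * a + (a * y) ^ 2 * (s ^ 2 * q.polar (U₀.val.col 1) (U₀.val.col 1) +
      2 * s * t * q.polar (U₀.val.col 1) (U₀.val.col 2) +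
      t ^ 2 * q.polar (U₀.val.col 2) (U₀.val.col 2)), ?_⟩
    simp only [TernaryForm.polar_eq, Pi.add_apply, Pi.smul_apply, smul_eq_mul] at ha hb hc ⊢
    linear_combination ha - 2 * p * a * y * s * hb - 2 * p * a * y * t * hc -
      2 * p * a * y * g * hst - p * a * hxy
  · rw [c0, c1]
    refine ⟨(-a * y) * (s * c * q.polar (U₀.val.col 1) (U₀.val.col 1) +
      (t * c - s * b) * q.polar (U₀.val.col 1) (U₀.val.col 2) -
      t * b * q.polar (U₀.val.col 2) (U₀.val.col 2)), ?_⟩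
    simp only [TernaryForm.polar_eq, Pi.add_apply, Pi.smul_apply, smul_eq_mul] at hb hc ⊢
    linear_combination c * hb - b * hc
  · have := congrFun c0 i
    simp only [Matrix.col_apply, Pi.add_apply, Pi.smul_apply, smul_eq_mul] at this
    rw [this]
    exact ⟨(-a * y) * s * U₀.val i 1 + (-a * y) * t * U₀.val i 2, by ring⟩

/-- Let `y` be the vector part of a trace zero `w` in the plane. By `norm_eq`, `adj Q y` is
isotropic modulo `p`; its primitive part lifts to a frame, whose `pairVec` is again proportional to
`w`. -/
theorem TernaryForm.IsIsotropic.exists_isFrame {q : TernaryForm} {p : ℕ} (hp : p.Prime)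
    (hd : ¬ (p : ℤ) ∣ q.Q.det) {T : GL (Fin 4) ℤ} (hT : q.IsIsotropic p T.val) :
    ∃ U : GL (Fin 3) ℤ, q.IsFrame p U.val ∧
      InPlane p T (q.pairVec (U.val.col 0) (U.val.col 1)) := by
  have hp' := Nat.prime_iff_prime_int.1 hp
  have h2 := not_dvd_two hd
  obtain ⟨w, hwT, hw0, hwN, hwp⟩ := hT.exists_trace_eq_zero hp hd
  set y : Fin 3 → ℤ := ![w 1, w 2, w 3] with hy
  obtain ⟨U₀, g, hg⟩ := exists_gl_col_zero (q.Q.adjugate *ᵥ y)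
  have hg' : q.Q.adjugate *ᵥ y = g • U₀.val.col 0 := by
    ext i; simpa using hg i
  have hyp : ¬ ∀ i, (p : ℤ) ∣ y i := fun h => by
    apply hwp
    have e0 : (p : ℤ) ∣ w 0 := by
      apply (hp'.dvd_or_dvd (?_ : (p : ℤ) ∣ 2 * w 0)).resolve_left h2
      rw [TernaryForm.trace, sub_eq_zero] at hw0
      rw [hw0]
      exact dvd_add (dvd_add ((h 0).mul_left _) ((h 1).mul_left _)) ((h 2).mul_left _)
    intro i
    fin_cases i
    · exact e0
    · exact h 0
    · exact h 1
    · exact h 2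
  have hQg : ∀ i, g * (q.Q *ᵥ U₀.val.col 0) i = q.Q.det * y i := fun i => by
    rw [← mulVec_adjugate_mulVec, hg', Matrix.mulVec_smul]; rfl
  have hgp : ¬ (p : ℤ) ∣ g := fun h => hyp fun i =>
    (hp'.dvd_or_dvd (hQg i ▸ h.mul_right _)).resolve_left hd
  have hiso : (p : ℤ) ∣ q.polar (U₀.val.col 0) (U₀.val.col 0) := by
    have e : g * (g * q.polar (U₀.val.col 0) (U₀.val.col 0)) =
        q.Q.det * (2 * (w ⬝ᵥ (q.N *ᵥ w))) := by
      have e1 : y ⬝ᵥ (q.Q.adjugate *ᵥ y) = 2 * (w ⬝ᵥ (q.N *ᵥ w)) := by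
        rw [q.norm_eq, hw0]; simp [hy]
      rw [← e1, hg']
      simp only [TernaryForm.polar, dotProduct, Finset.mul_sum, Pi.smul_apply, smul_eq_mul]
      refine Finset.sum_congr rfl fun i _ => ?_
      linear_combination g * U₀.val.col 0 i * hQg i
    exact (hp'.dvd_or_dvd ((hp'.dvd_or_dvd (e ▸ (hwN.mul_left _).mul_left _ :
      (p : ℤ) ∣ g * (g * q.polar (U₀.val.col 0) (U₀.val.col 0)))).resolve_left hgp)).resolve_left
        hgp
  obtain ⟨U, hU, hUU⟩ := q.exists_isFrame hp hd U₀ hiso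
  refine ⟨U, hU, ?_⟩
  set W := q.pairVec (U.val.col 0) (U.val.col 1) with hW
  set k := q.polar (U.val.col 0) (U.val.col 2) with hk
  have hkp : ¬ (p : ℤ) ∣ k := hU.not_dvd hp hd
  have hWy : ∀ i, (p : ℤ) ∣ g * k * W i.succ - U.val.det * q.Q.det * y i := fun i => by
    have e1 := hU.dvd_sub i
    have e2 : (p : ℤ) ∣ (q.Q *ᵥ U.val.col 0) i - (q.Q *ᵥ U₀.val.col 0) i := by
      have := dvd_mulVec (x := U.val.col 0 - U₀.val.col 0) hUU q.Q i
      rwa [Matrix.mulVec_sub] at this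
    obtain ⟨a, ha⟩ := e1
    obtain ⟨b, hb⟩ := e2
    exact ⟨U.val.det * g * b - g * a, by
      linear_combination U.val.det * g * hb - g * ha + U.val.det * hQg i⟩
  -- The factor `2` allows the zeroth coordinate to be recovered from the vector part and the
  -- vanishing trace.
  have hWw : ∀ i, (p : ℤ) ∣ 2 * (g * k) * W i - 2 * (U.val.det * q.Q.det) * w i := by
    have aux : ∀ i : Fin 3, (p : ℤ) ∣
        2 * (g * k) * W i.succ - 2 * (U.val.det * q.Q.det) * y i := fun i => by
      obtain ⟨a, ha⟩ := hWy i
      exact ⟨2 * a, by linear_combination 2 * ha⟩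
    have hWt : (p : ℤ) ∣ q.trace W := by rw [hW, q.trace_pairVec]; exact hU.2
    intro i
    refine Fin.cases ?_ (fun i => ?_) i
    · obtain ⟨a, ha⟩ := hWt
      obtain ⟨b₀, h₀⟩ : (p : ℤ) ∣ g * k * W 1 - U.val.det * q.Q.det * w 1 := hWy 0
      obtain ⟨b₁, h₁⟩ : (p : ℤ) ∣ g * k * W 2 - U.val.det * q.Q.det * w 2 := hWy 1
      obtain ⟨b₂, h₂⟩ : (p : ℤ) ∣ g * k * W 3 - U.val.det * q.Q.det * w 3 := hWy 2
      rw [TernaryForm.trace] at hw0 ha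
      exact ⟨g * k * a + q.B 0 * b₀ + q.B 1 * b₁ + q.B 2 * b₂, by
        linear_combination g * k * ha + q.B 0 * h₀ + q.B 1 * h₁ + q.B 2 * h₂ -
          U.val.det * q.Q.det * hw0⟩
    · have := aux i
      fin_cases i <;> exact this
  have hT' : ∀ i, (p : ℤ) ∣ ((T⁻¹).val *ᵥ w) i → (p : ℤ) ∣ ((T⁻¹).val *ᵥ W) i := fun i hi => by
    have h := dvd_mulVec (x := (2 * (g * k)) • W - (2 * (U.val.det * q.Q.det)) • w) hWw
      (T⁻¹).val i
    rw [Matrix.mulVec_sub, Matrix.mulVec_smul, Matrix.mulVec_smul] at h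
    have h := (dvd_iff_dvd_of_dvd_sub h).2 (hi.mul_left _)
    refine (hp'.dvd_or_dvd h).resolve_left fun h => ?_
    rcases hp'.dvd_or_dvd h with h | h
    · exact h2 h
    · exact (hp'.dvd_or_dvd h).elim hgp hkp
  exact ⟨hT' 2 hwT.1, hT' 3 hwT.2⟩

/-! ### Assembly -/

theorem subset_doubleCoset {n : ℕ} {D : Matrix (Fin n) (Fin n) ℤ}
    {S : Set (Matrix (Fin n) (Fin n) ℤ)} (h : S ∈ cosets D) : S ⊆ doubleCoset D := by
  obtain ⟨M, ⟨U, V, rfl⟩, rfl⟩ := h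
  rintro _ ⟨W, rfl⟩
  exact ⟨U, V * W, by rw [Units.val_mul, Matrix.mul_assoc]⟩

end CliffordLift

theorem theorem6p5 (q : CliffordLift.TernaryForm) (hq : q.Q.det ≠ 0)
    (p : ℕ) (hp : p.Prime) (hpq : IsCoprime (p : ℤ) q.Q.det) :
    (∀ 𝓜 ∈ CliffordLift.cosets (CliffordLift.D₄ p),
      (∃ M ∈ 𝓜, CliffordLift.CongZero p (CliffordLift.transform q.N M)) →
        ∃! 𝓐, 𝓐 ∈ CliffordLift.cosets (CliffordLift.D₃ p) ∧
          ∀ M ∈ 𝓜, ∀ A ∈ CliffordLift.doubleCoset (CliffordLift.D₃ p),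
            A ∈ 𝓐 ↔
              CliffordLift.CongZero (p ^ 2) (CliffordLift.transform q.Q A) ∧
                CliffordLift.LeftDivides M (q.Ψ p A)) ∧
    (∀ A ∈ CliffordLift.doubleCoset (CliffordLift.D₃ p),
      CliffordLift.CongZero (p ^ 2) (CliffordLift.transform q.Q A) →
        CliffordLift.IsIntegralOfRankMod p 1 (q.Ψ p A)) := by
  have hp' := Nat.prime_iff_prime_int.1 hp
  have hd : ¬ (p : ℤ) ∣ q.Q.det := (hp'.coprime_iff_not_dvd).1 hpq
  have h2 : IsCoprime (p : ℤ) 2 := (hp'.coprime_iff_not_dvd).2 (CliffordLift.not_dvd_two hd)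
  open CliffordLift in
  constructor
  · rintro _ ⟨M₀, ⟨T, V₀, rfl⟩, rfl⟩ ⟨M, ⟨V₁, rfl⟩, hM⟩
    have hT : q.IsIsotropic p T.val := by
      rw [congZero_transform_mul_unit] at hM
      exact q.isIsotropic_of_congZero T V₀ hM
    have hdiv : ∀ (W : GL (Fin 4) ℤ) (U V : GL (Fin 3) ℤ), q.IsFrame p U.val →
        (LeftDivides (T.val * D₄ p * V₀.val * W.val) (q.Ψ p (U.val * D₃ p * V.val)) ↔
          InPlane p T (q.pairVec (U.val.col 0) (U.val.col 1))) := fun W U V hU => by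
      obtain ⟨P, hP, hPc⟩ := q.Ψ_eq hp.ne_zero h2 U.val V.val hU
      obtain ⟨d, hcd⟩ := exists_dot_thirdMinors V
      rw [hP, Matrix.mul_assoc _ V₀.val, ← Units.val_mul]
      exact leftDivides_iff_inPlane T (V₀ * W) P hPc hcd
    obtain ⟨U, hU, hUT⟩ := hT.exists_isFrame hp hd
    have hmem : coset (U.val * D₃ p) ∈ cosets (D₃ p) :=
      ⟨_, ⟨U, 1, by simp⟩, rfl⟩
    have hiff : ∀ M ∈ coset (T.val * D₄ p * V₀.val), ∀ A ∈ doubleCoset (D₃ p),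
        A ∈ coset (U.val * D₃ p) ↔
          CongZero (p ^ 2) (transform q.Q A) ∧ LeftDivides M (q.Ψ p A) := by
      rintro _ ⟨W, rfl⟩ _ ⟨U', V', rfl⟩
      constructor
      · rintro ⟨V, hV⟩
        rw [hV]
        exact ⟨(q.congZero_iff_isFrame hp.ne_zero U V).2 hU, (hdiv W U V hU).2 hUT⟩
      · rintro ⟨hA, hL⟩
        have hU' := (q.congZero_iff_isFrame hp.ne_zero U' V').1 hA
        have hUT' := (hdiv W U' V' hU').1 hL
        -- Both `pairVec` vectors lie on the trace zero line of the plane, so the first columns are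
        -- proportional modulo `p` and the cosets agree.
        obtain ⟨X, hX⟩ := hU.mem_coset hp hd hU' (hU.par hp hd hU' (hT.par hp hd hUT
          (by rw [q.trace_pairVec]; exact hU.2) hUT' (by rw [q.trace_pairVec]; exact hU'.2)))
        exact ⟨X * V', by rw [hX, Units.val_mul, Matrix.mul_assoc]⟩
    refine ⟨_, ⟨hmem, hiff⟩, ?_⟩
    rintro S ⟨hS, hSiff⟩
    have hM₀ : T.val * D₄ p * V₀.val ∈ coset (T.val * D₄ p * V₀.val) := ⟨1, by simp⟩
    ext A
    constructor
    · intro hA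
      have hA' := subset_doubleCoset hS hA
      exact (hiff _ hM₀ A hA').2 ((hSiff _ hM₀ A hA').1 hA)
    · intro hA
      have hA' := subset_doubleCoset hmem hA
      exact (hSiff _ hM₀ A hA').2 ((hiff _ hM₀ A hA').1 hA)
  · rintro _ ⟨U, V, rfl⟩ hA
    have hU := (q.congZero_iff_isFrame hp.ne_zero U V).1 hA
    obtain ⟨P, hP, hPc⟩ := q.Ψ_eq hp.ne_zero h2 U.val V.val hU
    obtain ⟨d, hcd⟩ := exists_dot_thirdMinors V
    refine ⟨P, hP, rank_eq_one_of_congr hp P _ _ d hPc hcd ?_⟩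
    by_contra! h
    exact not_forall_dvd_pairVec q hp U fun i => h i.succ
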